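/- Let $\Lambda$ be a finite set of sites, let $N\ge 2$, let $U>0$, and let $\mathsf T=(t_{x,y})_{x,y\in\Lambda}$ be a positive semidefinite (Hermitian) complex matrix. On the fermionic Fock space generated by creation and annihilation operators $\hat c^\dagger_{x,\alpha},\hat c_{x,\alpha}$ ($x\in\Lambda$, $\alpha=1,\dots,N$) satisfying the canonical anticommutation relations, put $\hat n_{x,\alpha}=\hat c^\dagger_{x,\alpha}\hat c_{x,\alpha}$, $\hat N_c=\sum_{x,\alpha}\hat n_{x,\alpha}$, $\hat F^{\alpha,\beta}=\sum_{x}\hat c^\dagger_{x,\alpha}\hat c_{x,\beta}$, and consider the SU($N$) Hubbard Hamiltonian $$\hat H=\sum_{\alpha=1}^N\sum_{x,y\in\Lambda}t_{x,y}\,\hat c^\dagger_{x,\alpha}\hat c_{y,\alpha}+U\sum_{\alpha<\beta}\sum_{x\in\Lambda}\hat n_{x,\alpha}\hat n_{x,\beta}$$ and the quadratic Casimir operator $$\hat C_2=\frac12\Big(\sum_{\alpha,\beta=1}^N\hat F^{\alpha,\beta}\hat F^{\beta,\alpha}-\frac{\hat N_c^2}{N}\Big).$$ Let $D_0=\dim\ker\mathsf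 T$, let $\mathsf P_0$ be the matrix of the orthogonal projection of $\mathbb C^{\Lambda}$ onto $\ker\mathsf T$, and let $\Lambda_0=\{x\in\Lambda : (\mathsf P_0)_{x,x}\ne 0\}$. Set $N_c=D_0$, and let a ground state be a nonzero vector of the $N_c$-particle space $\{\Phi : \hat N_c\Phi=N_c\Phi\}$ that is an eigenvector of $\hat H$ for the lowest eigenvalue of $\hat H$ in that space. Then $$\frac{N_c(N-1)}{2}\Big(\frac{N_c}{N}+1\Big)$$ is the maximum eigenvalue of $\hat C_2$ in the $N_c$-particle space, and the following are equivalent: (i) the model exhibits SU($N$) ferromagnetism, i.e. every ground state $\Phi$ is fully polarized: $\hat C_2\Phi=\frac{N_c(N-1)}{2}\big(\frac{N_c}{N}+1\big)\Phi$; (ii) the matrix $\big((\mathsf P_0)_{x,y}\big)_{x,y\in\Lambda_0}$ is irreducible, i.e. there is no decomposition $\Lambda_0=\Lambda_1\cup\Lambda_2$ with $\Lambda_1\cap\Lambda_2=\emptyset$, $\Lambda_1\ne\emptyset$, $\Lambda_2\ne\emptyset$ and $(\mathsf P_0)_{x,y}=0$ for all $x\in\Lambda_1$, $y\in\Lambda_2$.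 -/

import Mathlib

open scoped ComplexOrder

noncomputable section

namespace SUNHubbard

/-! ### Fermionic Fock space over a finite, linearly ordered set of modes -/

section Fock

variable {M : Type*} [Fintype M] [LinearOrder M]

/-- The fermionic Fock space over the modes `M`, in the occupation number representation:
`Φ S` is the coefficient of `Φ` in the orthonormal basis vector
`c†_{i₁} ⋯ c†_{iₖ} |vac⟩`, where `S = {i₁ < ⋯ < iₖ}`. -/
abbrev Fock (M : Type*) [Fintype M] : Type _ := EuclideanSpace ℂ (Finset M)

/-- The annihilation operator of the mode `i`:
`c_i |S ∪ {i}⟩ = (-1)^{#{j ∈ S : j < i}} |S⟩` for `i ∉ S`, and `c_i |S⟩ = 0` if `i ∉ S`. -/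
def annihilate (i : M) : Module.End ℂ (Fock M) where
  toFun Φ := WithLp.toLp 2 fun S =>
    if i ∈ S then 0 else (-1) ^ (S.filter (· < i)).card * Φ (insert i S)
  map_add' Φ Ψ := by
    ext S
    by_cases h : i ∈ S <;> simp [h, mul_add]
  map_smul' a Φ := by
    ext S
    by_cases h : i ∈ S <;> simp [h, mul_left_comm]

/-- The creation operator of the mode `i`, the adjoint of the annihilation operator. -/
def create (i : M) : Module.End ℂ (Fock M) := LinearMap.adjoint (annihilate i)

end Fock

/-! ### The SU(N) Hubbard model -/

section Hubbard

variable {Λ : Type*} [Fintype Λ] [LinearOrder Λ] {N : ℕ}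

/-- The modes: pairs (site, color), ordered lexicographically. -/
abbrev Mode (Λ : Type*) (N : ℕ) : Type _ := Λ ×ₗ Fin N

/-- The operators on the Fock space of the lattice `Λ` with `N` colors. -/
abbrev Op (Λ : Type*) [Fintype Λ] (N : ℕ) : Type _ := Module.End ℂ (Fock (Mode Λ N))

/-- `c_{x,α}` -/
def c (x : Λ) (α : Fin N) : Op Λ N := annihilate (toLex (x, α))

/-- `c†_{x,α}` -/
def cdag (x : Λ) (α : Fin N) : Op Λ N := create (toLex (x, α))

/-- The number operator `n_{x,α} = c†_{x,α} c_{x,α}`. -/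
def num (x : Λ) (α : Fin N) : Op Λ N := cdag x α * c x α

variable (Λ N) in
/-- The total fermion number. -/
def totalNum : Op Λ N := ∑ x : Λ, ∑ α : Fin N, num x α

variable (N) in
/-- The hopping Hamiltonian. -/
def hop (T : Matrix Λ Λ ℂ) : Op Λ N :=
  ∑ α : Fin N, ∑ x : Λ, ∑ y : Λ, T x y • (cdag x α * c y α)

variable (Λ N) in
/-- The on-site interaction of strength `U` between different colors. -/
def interaction (U : ℝ) : Op Λ N :=
  (U : ℂ) • ∑ α : Fin N, ∑ β ∈ Finset.univ.filter (fun β : Fin N => α < β),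
    ∑ x : Λ, num x α * num x β

variable (N) in
/-- The Hamiltonian of the SU(N) Hubbard model. -/
def hamiltonian (T : Matrix Λ Λ ℂ) (U : ℝ) : Op Λ N := hop N T + interaction Λ N U

variable (Λ) in
/-- `F^{α,β} = ∑ₓ c†_{x,α} c_{x,β}` -/
def F (α β : Fin N) : Op Λ N := ∑ x : Λ, cdag x α * c x β

variable (Λ N) in
/-- The quadratic Casimir operator of SU(N). -/
def casimir : Op Λ N :=
  (1 / 2 : ℂ) • (∑ α : Fin N, ∑ β : Fin N, F Λ α β * F Λ β α
    - (1 / (N : ℂ)) • (totalNum Λ N * totalNum Λ N))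

variable (Λ N) in
/-- The space of states with `n` particles. -/
def sector (n : ℕ) : Submodule ℂ (Fock (Mode Λ N)) :=
  Module.End.eigenspace (totalNum Λ N) (n : ℂ)

/-- The (real) eigenvalues of `A` with an eigenvector in the `n`-particle space. -/
def sectorEigenvalues (A : Op Λ N) (n : ℕ) : Set ℝ :=
  {E | ∃ Φ ∈ sector Λ N n, Φ ≠ 0 ∧ A Φ = (E : ℂ) • Φ}

/-- `Φ` is a ground state of `H` with `n` particles: an eigenvector in the `n`-particle space
for the lowest eigenvalue of `H` in that space. -/
def IsGroundState (H : Op Λ N) (n : ℕ) (Φ : Fock (Mode Λ N)) : Prop :=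
  Φ ∈ sector Λ N n ∧ Φ ≠ 0 ∧
    ∃ E : ℝ, IsLeast (sectorEigenvalues H n) E ∧ H Φ = (E : ℂ) • Φ

/-- The Casimir eigenvalue `n (N - 1) / 2 * (n / N + 1)` of the fully polarized states
of `n` particles. -/
def polarizedValue (N n : ℕ) : ℝ := (n : ℝ) * ((N : ℝ) - 1) / 2 * ((n : ℝ) / (N : ℝ) + 1)

variable (N) in
/-- The Hubbard model with `n` particles exhibits SU(N) ferromagnetism: every ground state is
fully polarized. -/
def IsFerromagnetic (T : Matrix Λ Λ ℂ) (U : ℝ) (n : ℕ) : Prop :=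
  ∀ Φ : Fock (Mode Λ N), IsGroundState (hamiltonian N T U) n Φ →
    casimir Λ N Φ = (polarizedValue N n : ℂ) • Φ

end Hubbard

/-! ### The single-particle kernel and its projection matrix -/

section Kernel

variable {Λ : Type*} [Fintype Λ] [DecidableEq Λ]

/-- The kernel of the hopping matrix, in the single-particle Hilbert space. -/
def kerSpace (T : Matrix Λ Λ ℂ) : Submodule ℂ (EuclideanSpace ℂ Λ) :=
  LinearMap.ker (Matrix.toEuclideanLin T)

/-- The dimension of the kernel. -/
def kerDim (T : Matrix Λ Λ ℂ) : ℕ := Module.finrank ℂ (kerSpace T)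

/-- The matrix of the orthogonal projection onto the kernel. -/
def projMatrix (T : Matrix Λ Λ ℂ) : Matrix Λ Λ ℂ :=
  Matrix.of fun x y => (kerSpace T).starProjection (EuclideanSpace.single y (1 : ℂ)) x

/-- The set of sites `x` with `P x x ≠ 0`. -/
def diagSupport (P : Matrix Λ Λ ℂ) : Set Λ := {x | P x x ≠ 0}

/-- `(P x y)_{x, y ∈ L}` is reducible: `L` splits into two nonempty parts without a matrix
element of `P` from the first to the second. -/
def IsReducibleOn (P : Matrix Λ Λ ℂ) (L : Set Λ) : Prop :=
  ∃ L₁ L₂ : Set Λ, L = L₁ ∪ L₂ ∧ Disjoint L₁ L₂ ∧ L₁.Nonempty ∧ L₂.Nonempty ∧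
    ∀ x ∈ L₁, ∀ y ∈ L₂, P x y = 0

/-- `(P x y)_{x, y ∈ L}` is irreducible, i.e. not reducible. -/
def IsIrreducibleOn (P : Matrix Λ Λ ℂ) (L : Set Λ) : Prop := ¬ IsReducibleOn P L

end Kernel

end SUNHubbard

end

noncomputable section

namespace SUNHubbard

/-! Everything is read off from the reductions `c x α Φ` of a state; no Slater determinant is
expanded.

Up to constants fixed by the particle number, the Casimir operator is minus a sum of terms A†A,
where A = `colorAntisymm` annihilates two particles antisymmetrically in their colors
(`casimir_apply`). This bounds its eigenvalues, and full polarization means c_{y,β} c_{x,α} Φ =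
c_{y,α} c_{x,β} Φ throughout. The Hamiltonian is likewise a sum of terms A†A, and a one-color state
filling ker T has energy zero (`exists_isFilledSea`). So with dim ker T particles the ground states
are the nonzero states whose reductions y ↦ c_{y,α} Φ lie in ker T and which have no doubly occupied
site.

If P₀ is reducible, its blocks decouple. Recoloring the filled sea on one block gives again a state
of energy zero. Were it color symmetric, the sea could not hold a particle in each block, although
the kernel has weight in both (`not_isFerromagnetic_of_isReducibleOn`).

If P₀ is irreducible, take dim ker T sites I whose evaluations form a basis of the dual of ker T,
with dual basis `l`. There are as many particles as sites in I and no site is doubly occupied, so Φ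
acts like one spin per site of I. If two orbitals overlap at x, the absence of double occupancy at x
forces exchange symmetry of their colors (`colorAntisymm_of_overlap`). This symmetry is transitive
(`colorAntisymm_trans`), and irreducibility makes the overlap graph connected
(`IsEvaluationBasis.connected`). -/

lemma card_filter_lt_insert {M : Type*} [LinearOrder M] (i j : M) (S : Finset M) (h : j ∉ S) :
    ((insert j S).filter (· < i)).card = (S.filter (· < i)).card + if j < i then 1 else 0 := by
  rw [Finset.filter_insert]
  split_ifs with hji
  · rw [Finset.card_insert_of_notMem (by simp [h])]
  · rfl

/-! ### Canonical anticommutation relations -/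

section CAR

variable {M : Type*} [Fintype M] [LinearOrder M]

lemma annihilate_apply (i : M) (Φ : Fock M) (S : Finset M) :
    annihilate i Φ S = if i ∈ S then 0 else (-1) ^ (S.filter (· < i)).card * Φ (insert i S) := rfl

/-- The explicit action of the creation operator. -/
lemma create_apply (i : M) (Φ : Fock M) (S : Finset M) :
    create i Φ S =
      if i ∈ S then (-1) ^ ((S.erase i).filter (· < i)).card * Φ (S.erase i) else 0 := by
  have h : create i Φ S = inner ℂ (annihilate i (EuclideanSpace.single S (1 : ℂ))) Φ := by
    rw [← LinearMap.adjoint_inner_right]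
    simp [create, EuclideanSpace.inner_single_left]
  rw [h, PiLp.inner_apply]
  simp only [annihilate_apply]
  by_cases hi : i ∈ S
  · rw [Finset.sum_eq_single (S.erase i)]
    · simp [hi, Finset.insert_erase hi, mul_comm]
    · intro R _ hR
      by_cases hiR : i ∈ R
      · simp [hiR]
      · have : insert i R ≠ S := fun e => hR (by rw [← e, Finset.erase_insert hiR])
        simp [hiR, this]
    · simp
  · rw [if_neg hi]
    apply Finset.sum_eq_zero
    intro R _
    have : insert i R ≠ S := fun e => hi (e ▸ Finset.mem_insert_self i R)
    by_cases hiR : i ∈ R <;> simp [hiR, this]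

lemma annihilate_anticomm_apply (i j : M) (Φ : Fock M) :
    annihilate i (annihilate j Φ) = -annihilate j (annihilate i Φ) := by
  ext S
  simp only [PiLp.neg_apply, annihilate_apply, Finset.mem_insert]
  rcases eq_or_ne i j with rfl | hij
  · simp
  by_cases hi : i ∈ S
  · simp [hi]
  by_cases hj : j ∈ S
  · simp [hj]
  simp only [hi, hj, hij, hij.symm, if_false, or_false]
  rw [card_filter_lt_insert _ _ _ hi, card_filter_lt_insert _ _ _ hj, Finset.insert_comm j i]
  rcases hij.lt_or_gt with h | h <;> simp [h, h.not_gt, pow_succ] <;> ring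

/-- The canonical anticommutation relation between annihilation operators. -/
lemma annihilate_anticomm (i j : M) :
    annihilate i * annihilate j = -(annihilate j * annihilate i) :=
  LinearMap.ext fun Φ => annihilate_anticomm_apply i j Φ

/-- The canonical anticommutation relation between annihilation and creation operators. -/
lemma annihilate_create (i j : M) :
    annihilate i * create j = (if i = j then 1 else 0) - create j * annihilate i := by
  ext Φ S
  rcases eq_or_ne i j with rfl | hij
  · simp only [Module.End.mul_apply, LinearMap.sub_apply, PiLp.sub_apply, annihilate_apply,
      create_apply, if_true, Module.End.one_apply]
    by_cases hi : i ∈ S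
    · simp only [hi, if_true, Finset.notMem_erase, if_false, Finset.insert_erase hi]
      rw [← mul_assoc, ← mul_pow]; simp
    · simp only [hi, if_false, Finset.mem_insert_self, if_true, Finset.erase_insert hi]
      rw [← mul_assoc, ← mul_pow]; simp
  · simp only [Module.End.mul_apply, LinearMap.sub_apply, PiLp.sub_apply, annihilate_apply,
      create_apply, hij, if_false, LinearMap.zero_apply, PiLp.zero_apply, Finset.mem_insert,
      hij.symm, false_or, Finset.mem_erase]
    by_cases hi : i ∈ S
    · simp [hi, hij]
    by_cases hj : j ∈ S
    · obtain ⟨R, hjR, rfl⟩ : ∃ R, j ∉ R ∧ insert j R = S :=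
        ⟨S.erase j, Finset.notMem_erase j S, Finset.insert_erase hj⟩
      have hiR : i ∉ R := fun h => hi (Finset.mem_insert_of_mem h)
      have e1 : (insert i (insert j R)).erase j = insert i R := by
        rw [Finset.insert_comm, Finset.erase_insert (by simp [hij.symm, hjR])]
      simp only [hi, hj, if_true, if_false, e1, Finset.erase_insert hjR, and_false]
      rw [card_filter_lt_insert _ _ _ hjR, card_filter_lt_insert _ _ _ hiR]
      rcases hij.lt_or_gt with h | h <;> simp [h, h.not_gt, pow_succ] <;> ring
    · simp [hi, hj]

end CAR

lemma inner_self_eq_ofReal {E : Type*} [NormedAddCommGroup E] [InnerProductSpace ℂ E] (Φ : E) :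
    inner ℂ Φ Φ = ((‖Φ‖ ^ 2 : ℝ) : ℂ) := by
  rw [inner_self_eq_norm_sq_to_K]
  push_cast
  rfl

/-! ### Sums of terms A†A -/

section Positivity

variable {E ι : Type*} [NormedAddCommGroup E] [InnerProductSpace ℂ E] [FiniteDimensional ℂ E]

lemma inner_sum_adjoint_mul_self (s : Finset ι) (A : ι → Module.End ℂ E) (Φ : E) :
    inner ℂ Φ ((∑ i ∈ s, LinearMap.adjoint (A i) * A i) Φ) = ((∑ i ∈ s, ‖A i Φ‖ ^ 2 : ℝ) : ℂ) := by
  rw [LinearMap.sum_apply, inner_sum]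
  push_cast
  refine Finset.sum_congr rfl fun i _ => ?_
  rw [Module.End.mul_apply, LinearMap.adjoint_inner_right, inner_self_eq_norm_sq_to_K]
  rfl

lemma sum_adjoint_mul_self_eq_zero_iff (s : Finset ι) (A : ι → Module.End ℂ E) (Φ : E) :
    (∑ i ∈ s, LinearMap.adjoint (A i) * A i) Φ = 0 ↔ ∀ i ∈ s, A i Φ = 0 := by
  constructor
  · intro h
    have h1 := inner_sum_adjoint_mul_self s A Φ
    rw [h, inner_zero_right] at h1
    have h2 : ∑ i ∈ s, ‖A i Φ‖ ^ 2 = 0 := by exact_mod_cast h1.symm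
    rw [Finset.sum_eq_zero_iff_of_nonneg (fun _ _ => by positivity)] at h2
    intro i hi
    simpa using h2 i hi
  · intro h
    rw [LinearMap.sum_apply]
    exact Finset.sum_eq_zero fun i hi => by rw [Module.End.mul_apply, h i hi, map_zero]

end Positivity

/-! ### Site and color operators, particle number -/

section Modes

variable {Λ : Type*} [Fintype Λ] [LinearOrder Λ] {N : ℕ}

lemma c_anticomm (x y : Λ) (α β : Fin N) : c x α * c y β = -(c y β * c x α) :=
  annihilate_anticomm _ _

lemma c_anticomm_apply (x y : Λ) (α β : Fin N) (Φ : Fock (Mode Λ N)) :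
    c x α (c y β Φ) = -c y β (c x α Φ) :=
  annihilate_anticomm_apply _ _ _

lemma c_self_apply (x : Λ) (α : Fin N) (Φ : Fock (Mode Λ N)) : c x α (c x α Φ) = 0 := by
  have h := eq_neg_iff_add_eq_zero.mp (c_anticomm_apply x x α α Φ)
  rw [← two_smul ℂ] at h
  exact (smul_eq_zero.mp h).resolve_left two_ne_zero

lemma c_mul_cdag (x y : Λ) (α β : Fin N) :
    c x α * cdag y β = (if x = y ∧ α = β then 1 else 0) - cdag y β * c x α := by
  rw [c, cdag, annihilate_create]
  simp [Prod.ext_iff]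

lemma c_cdag_apply (x y : Λ) (α β : Fin N) (Φ : Fock (Mode Λ N)) :
    c x α (cdag y β Φ) = (if x = y ∧ α = β then Φ else 0) - cdag y β (c x α Φ) := by
  have := LinearMap.congr_fun (c_mul_cdag x y α β) Φ
  rw [Module.End.mul_apply] at this
  rw [this]
  split_ifs <;> simp

lemma adjoint_c (x : Λ) (α : Fin N) : LinearMap.adjoint (c x α) = cdag x α := rfl

lemma adjoint_cdag (x : Λ) (α : Fin N) : LinearMap.adjoint (cdag x α) = c x α :=
  LinearMap.adjoint_adjoint _

lemma adjoint_mul {E : Type*} [NormedAddCommGroup E] [InnerProductSpace ℂ E]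
    [FiniteDimensional ℂ E] (A B : Module.End ℂ E) :
    LinearMap.adjoint (A * B) = LinearMap.adjoint B * LinearMap.adjoint A :=
  LinearMap.adjoint_comp _ _

lemma c_mul_num (x y : Λ) (α β : Fin N) :
    c x α * num y β = num y β * c x α + if x = y ∧ α = β then c x α else 0 := by
  rw [num, ← mul_assoc, c_mul_cdag, sub_mul, mul_assoc, c_anticomm x y]
  split_ifs with h
  · rw [h.1, h.2]; simp [mul_assoc, add_comm]
  · simp [mul_assoc]

lemma c_mul_totalNum (x : Λ) (α : Fin N) :
    c x α * totalNum Λ N = totalNum Λ N * c x α + c x α := by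
  simp_rw [totalNum, Finset.mul_sum, c_mul_num, Finset.sum_add_distrib, Finset.sum_mul, ite_and]
  simp

lemma totalNum_c_apply {x : Λ} {α : Fin N} {Φ : Fock (Mode Λ N)} {a : ℂ}
    (h : totalNum Λ N Φ = a • Φ) : totalNum Λ N (c x α Φ) = (a - 1) • c x α Φ := by
  have := LinearMap.congr_fun (c_mul_totalNum x α) Φ
  simp only [Module.End.mul_apply, LinearMap.add_apply, h, map_smul] at this
  rw [sub_smul, one_smul, this, add_sub_cancel_right]

lemma adjoint_totalNum : LinearMap.adjoint (totalNum Λ N) = totalNum Λ N := by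
  simp only [totalNum, map_sum, num, adjoint_mul, adjoint_c, adjoint_cdag]

lemma totalNum_mul_cdag (x : Λ) (α : Fin N) :
    totalNum Λ N * cdag x α = cdag x α * totalNum Λ N + cdag x α := by
  have := congrArg LinearMap.adjoint (c_mul_totalNum x α)
  simpa only [map_add, adjoint_mul, adjoint_c, adjoint_totalNum] using this

lemma totalNum_cdag_apply {x : Λ} {α : Fin N} {Φ : Fock (Mode Λ N)} {a : ℂ}
    (h : totalNum Λ N Φ = a • Φ) : totalNum Λ N (cdag x α Φ) = (a + 1) • cdag x α Φ := by
  have := LinearMap.congr_fun (totalNum_mul_cdag x α) Φ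
  simp only [Module.End.mul_apply, LinearMap.add_apply, h, map_smul] at this
  rw [add_smul, one_smul, this]

lemma mem_sector {n : ℕ} {Φ : Fock (Mode Λ N)} :
    Φ ∈ sector Λ N n ↔ totalNum Λ N Φ = (n : ℂ) • Φ :=
  Module.End.mem_eigenspace_iff

lemma eq_zero_of_c_eq_zero {Φ : Fock (Mode Λ N)} {a : ℂ} (h : totalNum Λ N Φ = a • Φ)
    (ha : a ≠ 0) (hc : ∀ x α, c x α Φ = 0) : Φ = 0 := by
  have : totalNum Λ N Φ = 0 := by simp [totalNum, num, hc]
  rw [h] at this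
  exact (smul_eq_zero.mp this).resolve_left ha

end Modes

/-! ### The Casimir operator and color antisymmetrization -/

section Casimir

variable {Λ : Type*} [Fintype Λ] [LinearOrder Λ] {N : ℕ}

lemma c_mul_cdag_mul_c (x y : Λ) (α β γ : Fin N) :
    c x γ * (cdag y β * c y α) =
      cdag y β * c y α * c x γ + if x = y then (if γ = β then c y α else 0) else 0 := by
  rw [← mul_assoc, c_mul_cdag, sub_mul, mul_assoc, c_anticomm x y, ite_and]
  split_ifs <;> simp [mul_assoc, add_comm]

lemma c_mul_F (x : Λ) (α β γ : Fin N) :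
    c x γ * F Λ β α = F Λ β α * c x γ + if γ = β then c x α else 0 := by
  simp_rw [F, Finset.mul_sum, c_mul_cdag_mul_c, Finset.sum_add_distrib, Finset.sum_mul]
  simp

lemma num_mul_totalNum (x : Λ) (α : Fin N) :
    num x α * totalNum Λ N = cdag x α * totalNum Λ N * c x α + num x α := by
  rw [num, mul_assoc, c_mul_totalNum, mul_add, mul_assoc]

lemma totalNum_mul_self :
    totalNum Λ N * totalNum Λ N =
      (∑ x : Λ, ∑ α : Fin N, cdag x α * totalNum Λ N * c x α) + totalNum Λ N := by
  conv_lhs => rw [totalNum, Finset.sum_mul]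
  simp_rw [Finset.sum_mul]
  change ∑ x : Λ, ∑ α : Fin N, num x α * totalNum Λ N = _
  simp_rw [num_mul_totalNum, Finset.sum_add_distrib]
  rfl

lemma F_mul_F (α β : Fin N) :
    F Λ α β * F Λ β α = (∑ x : Λ, cdag x α * F Λ β α * c x β) + ∑ x : Λ, num x α := by
  conv_lhs => rw [F, Finset.sum_mul]
  simp_rw [mul_assoc, c_mul_F, if_true, mul_add, Finset.sum_add_distrib]
  rfl

/-- The antisymmetrization in the colors of the annihilation of two particles, at `x` and `y`. -/
def colorAntisymm (p : (Λ × Λ) × (Fin N × Fin N)) : Op Λ N :=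
  c p.1.2 p.2.2 * c p.1.1 p.2.1 - c p.1.2 p.2.1 * c p.1.1 p.2.2

/-- Each A†A has two direct and two exchange terms. The two of each kind differ by swapping the
colors, so after summation they agree; hence the factor 2. -/
lemma sum_colorAntisymm :
    ∑ p : (Λ × Λ) × (Fin N × Fin N), LinearMap.adjoint (colorAntisymm p) * colorAntisymm p =
      (2 : ℂ) • ((∑ x : Λ, ∑ α : Fin N, cdag x α * totalNum Λ N * c x α)
        - ∑ α : Fin N, ∑ β : Fin N, ∑ x : Λ, cdag x α * F Λ β α * c x β) := by
  have h (x y : Λ) (α β : Fin N) :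
      LinearMap.adjoint (colorAntisymm ((x, y), (α, β))) * colorAntisymm ((x, y), (α, β)) =
        cdag x α * num y β * c x α - cdag x α * (cdag y β * c y α) * c x β
        + (cdag x β * num y α * c x β - cdag x β * (cdag y α * c y β) * c x α) := by
    simp only [colorAntisymm, map_sub, adjoint_mul, adjoint_c, num]
    noncomm_ring
  have hV : ∑ x : Λ, ∑ α : Fin N, cdag x α * totalNum Λ N * c x α =
      ∑ x : Λ, ∑ y : Λ, ∑ α : Fin N, ∑ β : Fin N, cdag x α * num y β * c x α := by
    refine Finset.sum_congr rfl fun x _ => ?_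
    rw [Finset.sum_comm]
    simp_rw [totalNum, Finset.mul_sum, Finset.sum_mul]
  have hW : ∑ α : Fin N, ∑ β : Fin N, ∑ x : Λ, cdag x α * F Λ β α * c x β =
      ∑ x : Λ, ∑ y : Λ, ∑ α : Fin N, ∑ β : Fin N, cdag x α * (cdag y β * c y α) * c x β := by
    simp_rw [F, Finset.mul_sum, Finset.sum_mul]
    have aux (f : Fin N → Fin N → Λ → Λ → Op Λ N) :
        ∑ α, ∑ β, ∑ x, ∑ y, f α β x y = ∑ x, ∑ y, ∑ α, ∑ β, f α β x y :=
      Finset.sum_comm_cycle.trans (Finset.sum_congr rfl fun x _ => Finset.sum_comm_cycle)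
    exact aux fun α β x y => cdag x α * (cdag y β * c y α) * c x β
  have hsum (f g : Λ → Λ → Fin N → Fin N → Op Λ N) :
      ∑ x, ∑ y, ∑ α, ∑ β, (f x y α β - g x y α β + (f x y β α - g x y β α)) =
        (2 : ℂ) • (∑ x, ∑ y, ∑ α, ∑ β, f x y α β - ∑ x, ∑ y, ∑ α, ∑ β, g x y α β) := by
    have hswap (f : Λ → Λ → Fin N → Fin N → Op Λ N) :
        ∑ x, ∑ y, ∑ α, ∑ β, f x y β α = ∑ x, ∑ y, ∑ α, ∑ β, f x y α β :=
      Finset.sum_congr rfl fun x _ => Finset.sum_congr rfl fun y _ => Finset.sum_comm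
    simp_rw [Finset.sum_add_distrib, Finset.sum_sub_distrib, hswap f, hswap g, two_smul]
  rw [hV, hW, ← hsum]
  simp_rw [Fintype.sum_prod_type, h]

/-- Normal ordering turns the F F terms into exchange terms plus N times the particle number, and
the squared particle number into direct terms plus itself. The factor 1/4 is the 1/2 of the Casimir
operator times the 1/2 from `sum_colorAntisymm`. -/
lemma casimir_apply {n : ℕ} {Φ : Fock (Mode Λ N)} (hN : N ≠ 0) (h : Φ ∈ sector Λ N n) :
    casimir Λ N Φ = (polarizedValue N n : ℂ) • Φ - (1 / 4 : ℂ) •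
      (∑ p : (Λ × Λ) × (Fin N × Fin N),
        LinearMap.adjoint (colorAntisymm p) * colorAntisymm p) Φ := by
  rw [mem_sector] at h
  have h2 : (totalNum Λ N * totalNum Λ N) Φ = ((n : ℂ) * n) • Φ := by
    rw [Module.End.mul_apply, h, map_smul, h, smul_smul]
  have hV := LinearMap.congr_fun (totalNum_mul_self (Λ := Λ) (N := N)) Φ
  rw [h2, LinearMap.add_apply, h, ← sub_eq_iff_eq_add] at hV
  have hF : (∑ α : Fin N, ∑ β : Fin N, F Λ α β * F Λ β α) =
      (∑ α : Fin N, ∑ β : Fin N, ∑ x : Λ, cdag x α * F Λ β α * c x β)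
        + (N : ℂ) • totalNum Λ N := by
    simp_rw [F_mul_F, Finset.sum_add_distrib]
    congr 1
    rw [Finset.sum_comm, Finset.sum_comm]
    simp [totalNum, Finset.sum_comm (s := (Finset.univ : Finset Λ)), Finset.smul_sum,
      ← Nat.cast_smul_eq_nsmul ℂ]
  rw [sum_colorAntisymm, casimir, hF]
  simp only [LinearMap.smul_apply, LinearMap.sub_apply, LinearMap.add_apply, h, h2, ← hV]
  have hN' : (N : ℂ) ≠ 0 := Nat.cast_ne_zero.mpr hN
  rw [polarizedValue]
  push_cast
  match_scalars
  · norm_num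
  · field_simp
    ring

lemma casimir_eigenvalue_le {n : ℕ} (hN : N ≠ 0) {E : ℝ}
    (h : E ∈ sectorEigenvalues (casimir Λ N) n) : E ≤ polarizedValue N n := by
  obtain ⟨Φ, hΦ, h0, hE⟩ := h
  rw [casimir_apply hN hΦ] at hE
  have h1 := congrArg (inner ℂ Φ) hE
  rw [inner_sub_right, inner_smul_right, inner_smul_right, inner_smul_right,
    inner_sum_adjoint_mul_self, inner_self_eq_ofReal] at h1
  have h2 : polarizedValue N n * ‖Φ‖ ^ 2
      - 1 / 4 * ∑ p : (Λ × Λ) × (Fin N × Fin N), ‖colorAntisymm p Φ‖ ^ 2 = E * ‖Φ‖ ^ 2 := by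
    have aux (a b s e : ℝ) (h : (a : ℂ) * b - 1 / 4 * (s : ℂ) = e * b) :
        a * b - 1 / 4 * s = e * b := by
      apply Complex.ofReal_injective
      push_cast
      exact h
    exact aux _ _ _ _ h1
  have h3 : 0 ≤ ∑ p : (Λ × Λ) × (Fin N × Fin N), ‖colorAntisymm p Φ‖ ^ 2 := by positivity
  have h4 : 0 < ‖Φ‖ ^ 2 := by positivity
  by_contra! h5
  nlinarith

/-- The fully polarized states are those annihilated by all color antisymmetrizations. -/
lemma casimir_eq_polarizedValue_iff {n : ℕ} (hN : N ≠ 0) {Φ : Fock (Mode Λ N)}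
    (h : Φ ∈ sector Λ N n) :
    casimir Λ N Φ = (polarizedValue N n : ℂ) • Φ ↔
      ∀ x y α β, c y β (c x α Φ) = c y α (c x β Φ) := by
  rw [casimir_apply hN h, sub_eq_self, smul_eq_zero, or_iff_right (by norm_num),
    sum_adjoint_mul_self_eq_zero_iff]
  simp [colorAntisymm, sub_eq_zero]

end Casimir

open scoped MatrixOrder Matrix.Norms.L2Operator Matrix in
lemma exists_eq_conjTranspose_mul_self {n : Type*} [Fintype n] [DecidableEq n] {T : Matrix n n ℂ}
    (hT : T.PosSemidef) : ∃ B : Matrix n n ℂ, T = Bᴴ * B :=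
  CStarAlgebra.nonneg_iff_eq_star_mul_self.mp hT.nonneg

/-! ### Positivity of the Hamiltonian and its zero-energy states -/

section Hamiltonian

variable {Λ : Type*} [Fintype Λ] [LinearOrder Λ] {N : ℕ}

open scoped Matrix in
lemma hop_conjTranspose_mul_self (B : Matrix Λ Λ ℂ) :
    hop N (Bᴴ * B) = ∑ p : Fin N × Λ, LinearMap.adjoint (∑ y, B p.2 y • c y p.1) *
      ∑ y, B p.2 y • c y p.1 := by
  simp_rw [Fintype.sum_prod_type, map_sum, map_smulₛₗ, adjoint_c, hop]
  refine Finset.sum_congr rfl fun α _ => ?_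
  simp_rw [Finset.sum_mul, Finset.mul_sum, Matrix.mul_apply, Finset.sum_smul,
    Matrix.conjTranspose_apply, smul_mul_smul_comm]
  exact Finset.sum_comm_cycle.trans rfl

/-- For different colors, two anticommutations turn n_α n_β into (c_β c_α)†(c_β c_α). -/
lemma interaction_eq_smul_sum (U : ℝ) :
    interaction Λ N U = (U : ℂ) •
      ∑ p ∈ (Finset.univ : Finset ((Fin N × Fin N) × Λ)).filter (fun p => p.1.1 < p.1.2),
        LinearMap.adjoint (c p.2 p.1.2 * c p.2 p.1.1) * (c p.2 p.1.2 * c p.2 p.1.1) := by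
  rw [interaction]
  congr 1
  simp_rw [Finset.sum_filter, Fintype.sum_prod_type, adjoint_mul, adjoint_c]
  refine Finset.sum_congr rfl fun α _ => Finset.sum_congr rfl fun β _ => ?_
  split_ifs with h
  · refine Finset.sum_congr rfl fun x _ => ?_
    have h1 : c x α * cdag x β = -(cdag x β * c x α) := by
      rw [c_mul_cdag, if_neg (fun e => h.ne e.2), zero_sub]
    calc num x α * num x β = cdag x α * (c x α * cdag x β) * c x β := by
          simp only [num, mul_assoc]
      _ = -(cdag x α * cdag x β * (c x α * c x β)) := by rw [h1]; noncomm_ring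
      _ = _ := by rw [c_anticomm x x α β]; noncomm_ring
  · simp

lemma sum_smul_c_apply (v : Λ → ℂ) (α : Fin N) (Φ : Fock (Mode Λ N)) :
    (∑ y, v y • c y α) Φ = ∑ y, v y • c y α Φ := by
  simp

lemma hop_apply (T : Matrix Λ Λ ℂ) (Φ : Fock (Mode Λ N)) :
    hop N T Φ = ∑ α, ∑ x, cdag x α (∑ y, T x y • c y α Φ) := by
  simp only [hop, LinearMap.sum_apply, LinearMap.smul_apply, Module.End.mul_apply, map_sum,
    map_smul]

lemma inner_hamiltonian (B : Matrix Λ Λ ℂ) (U : ℝ) (Φ : Fock (Mode Λ N)) :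
    inner ℂ Φ (hamiltonian N (Matrix.conjTranspose B * B) U Φ) =
      ((∑ p : Fin N × Λ, ‖(∑ y, B p.2 y • c y p.1) Φ‖ ^ 2 +
        U * ∑ p ∈ (Finset.univ : Finset ((Fin N × Fin N) × Λ)).filter (fun p => p.1.1 < p.1.2),
          ‖(c p.2 p.1.2 * c p.2 p.1.1) Φ‖ ^ 2 : ℝ) : ℂ) := by
  rw [hamiltonian, hop_conjTranspose_mul_self, interaction_eq_smul_sum, LinearMap.add_apply,
    LinearMap.smul_apply, inner_add_right, inner_smul_right,
    inner_sum_adjoint_mul_self, inner_sum_adjoint_mul_self, Complex.ofReal_add,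
    Complex.ofReal_mul]

/-- For a positive semidefinite hopping matrix and a repulsive interaction, the energy
is nonnegative. -/
lemma hamiltonian_eigenvalue_nonneg {T : Matrix Λ Λ ℂ} (hT : T.PosSemidef) {U : ℝ} (hU : 0 < U)
    {n : ℕ} {E : ℝ} (h : E ∈ sectorEigenvalues (hamiltonian N T U) n) : 0 ≤ E := by
  obtain ⟨Φ, -, h0, hE⟩ := h
  obtain ⟨B, hB⟩ := exists_eq_conjTranspose_mul_self hT
  have h1 := congrArg (inner ℂ Φ) hE
  rw [hB, inner_hamiltonian, inner_smul_right, inner_self_eq_ofReal, ← Complex.ofReal_mul,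
    Complex.ofReal_inj] at h1
  refine nonneg_of_mul_nonneg_left (h1 ▸ ?_) (pow_pos (norm_pos_iff.mpr h0) 2)
  exact add_nonneg (Finset.sum_nonneg fun _ _ => sq_nonneg _)
    (mul_nonneg hU.le (Finset.sum_nonneg fun _ _ => sq_nonneg _))

/-- The states of zero energy: every one-particle reduction lies in the kernel of the hopping
matrix, and no site is occupied by particles of different colors. -/
lemma hamiltonian_apply_eq_zero_iff {T : Matrix Λ Λ ℂ} (hT : T.PosSemidef) {U : ℝ} (hU : 0 < U)
    {Φ : Fock (Mode Λ N)} :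
    hamiltonian N T U Φ = 0 ↔
      (∀ x α, ∑ y, T x y • c y α Φ = 0) ∧ ∀ x α β, c x β (c x α Φ) = 0 := by
  obtain ⟨B, rfl⟩ := exists_eq_conjTranspose_mul_self hT
  have hint : (∀ x α β, c x β (c x α Φ) = 0) ↔
      ∀ p ∈ (Finset.univ : Finset ((Fin N × Fin N) × Λ)).filter (fun p => p.1.1 < p.1.2),
        (c p.2 p.1.2 * c p.2 p.1.1) Φ = 0 := by
    constructor
    · intro h p _
      exact h _ _ _
    · intro h x α β
      rcases lt_trichotomy α β with hab | rfl | hab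
      · exact h ((α, β), x) (by simpa using hab)
      · exact c_self_apply x α Φ
      · rw [c_anticomm_apply, neg_eq_zero]
        exact h ((β, α), x) (by simpa using hab)
  -- The analogue of ker B†B = ker B: either condition is equivalent to the vanishing of the hopping
  -- term on Φ.
  have hhop : (∀ x α, ∑ y, (Matrix.conjTranspose B * B) x y • c y α Φ = 0) ↔
      ∀ p ∈ (Finset.univ : Finset (Fin N × Λ)), (∑ y, B p.2 y • c y p.1) Φ = 0 := by
    rw [← sum_adjoint_mul_self_eq_zero_iff, ← hop_conjTranspose_mul_self]
    constructor
    · intro h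
      simp only [hop_apply, h, map_zero, Finset.sum_const_zero]
    · intro h
      rw [hop_conjTranspose_mul_self, sum_adjoint_mul_self_eq_zero_iff] at h
      intro x α
      simp_rw [Matrix.mul_apply, Finset.sum_smul]
      rw [Finset.sum_comm]
      refine Finset.sum_eq_zero fun z _ => ?_
      have := h (α, z) (Finset.mem_univ _)
      rw [sum_smul_c_apply] at this
      simp_rw [mul_smul, ← Finset.smul_sum, this, smul_zero]
  rw [hhop, hint]
  constructor
  · intro h
    have h1 := congrArg (inner ℂ Φ) h
    rw [inner_hamiltonian, inner_zero_right, Complex.ofReal_eq_zero] at h1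
    rw [add_eq_zero_iff_of_nonneg (by positivity) (by positivity), mul_eq_zero,
      or_iff_right hU.ne', Finset.sum_eq_zero_iff_of_nonneg (fun _ _ => by positivity),
      Finset.sum_eq_zero_iff_of_nonneg (fun _ _ => by positivity)] at h1
    simpa using h1
  · rintro ⟨h1, h2⟩
    rw [← sum_adjoint_mul_self_eq_zero_iff] at h1 h2
    rw [hamiltonian, hop_conjTranspose_mul_self, interaction_eq_smul_sum, LinearMap.add_apply,
      LinearMap.smul_apply, h1, h2, smul_zero, add_zero]

end Hamiltonian

/-! ### The projection matrix onto the kernel -/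

section Projection

variable {Λ : Type*} [Fintype Λ] [DecidableEq Λ]

lemma projMatrix_mulVec (T : Matrix Λ Λ ℂ) (v : EuclideanSpace ℂ Λ) (x : Λ) :
    ∑ y, projMatrix T x y * v y = (kerSpace T).starProjection v x := by
  have h : v = ∑ y, v y • EuclideanSpace.single y (1 : ℂ) := by
    ext x
    simp [Pi.single_apply]
  conv_rhs => rw [h]
  simp [projMatrix, mul_comm]

lemma mem_kerSpace {T : Matrix Λ Λ ℂ} {v : EuclideanSpace ℂ Λ} :
    v ∈ kerSpace T ↔ ∀ x, ∑ y, T x y * v y = 0 := by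
  rw [kerSpace, LinearMap.mem_ker]
  constructor
  · intro h x
    exact congrArg (fun w : EuclideanSpace ℂ Λ => w x) h
  · intro h
    ext x
    exact h x

lemma projMatrix_conj (T : Matrix Λ Λ ℂ) (x y : Λ) :
    star (projMatrix T x y) = projMatrix T y x := by
  have h := (kerSpace T).inner_starProjection_left_eq_right
    (EuclideanSpace.single y (1 : ℂ)) (EuclideanSpace.single x 1)
  simpa [projMatrix, EuclideanSpace.inner_single_left, EuclideanSpace.inner_single_right] using h

lemma projMatrix_column_mem (T : Matrix Λ Λ ℂ) (y : Λ) :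
    WithLp.toLp 2 (fun x => projMatrix T x y) ∈ kerSpace T :=
  (kerSpace T).starProjection_apply_mem (EuclideanSpace.single y (1 : ℂ))

lemma sum_projMatrix_mul_of_mem {T : Matrix Λ Λ ℂ} {v : EuclideanSpace ℂ Λ}
    (h : v ∈ kerSpace T) (x : Λ) : ∑ y, projMatrix T x y * v y = v x := by
  rw [projMatrix_mulVec, Submodule.starProjection_eq_self_iff.mpr h]

lemma projMatrix_mul_self_apply (T : Matrix Λ Λ ℂ) (x y : Λ) :
    ∑ z, projMatrix T x z * projMatrix T z y = projMatrix T x y :=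
  sum_projMatrix_mul_of_mem (projMatrix_column_mem T y) x

lemma sum_mul_projMatrix (T : Matrix Λ Λ ℂ) (x y : Λ) : ∑ z, T x z * projMatrix T z y = 0 :=
  mem_kerSpace.mp (projMatrix_column_mem T y) x

lemma trace_projMatrix (T : Matrix Λ Λ ℂ) : ∑ x, projMatrix T x x = kerDim T := by
  have h : LinearMap.IsProj (kerSpace T) ((kerSpace T).starProjection : _ →ₗ[ℂ] _) :=
    ⟨fun v => (kerSpace T).starProjection_apply_mem v,
      fun v hv => Submodule.starProjection_eq_self_iff.mpr hv⟩
  rw [kerDim, ← h.trace, LinearMap.trace_eq_matrix_trace ℂ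
    (EuclideanSpace.basisFun Λ ℂ).toBasis, Matrix.trace]
  refine Finset.sum_congr rfl fun x _ => ?_
  simp [LinearMap.toMatrix_apply, projMatrix]

/-- Since P is a Hermitian idempotent, P x x is the squared norm of row x. -/
lemma projMatrix_self_ne_zero_of_ne_zero {T : Matrix Λ Λ ℂ} {x y : Λ}
    (h : projMatrix T x y ≠ 0) : projMatrix T x x ≠ 0 := by
  rw [← projMatrix_mul_self_apply]
  simp_rw [← projMatrix_conj T x, Complex.star_def, Complex.mul_conj]
  norm_cast
  refine (Finset.sum_pos' (fun _ _ => Complex.normSq_nonneg _)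
    ⟨y, Finset.mem_univ y, Complex.normSq_pos.mpr h⟩).ne'

end Projection

lemma sum_smul_map {ι E : Type*} [AddCommGroup E] [Module ℂ E] (s : Finset ι)
    (A : Module.End ℂ E) (a : ι → ℂ) (v : ι → E) :
    ∑ i ∈ s, a i • A (v i) = A (∑ i ∈ s, a i • v i) := by
  simp

/-! ### The filled sea and the ground states -/

section FilledSea

variable {Λ : Type*} [Fintype Λ] [LinearOrder Λ] {N : ℕ}

/-- The creation operator, with color `α`, of the projection of the site `x` to the kernel. -/
def createKer (T : Matrix Λ Λ ℂ) (α : Fin N) (x : Λ) : Op Λ N := ∑ y, projMatrix T y x • cdag y α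

lemma c_createKer_apply (T : Matrix Λ Λ ℂ) (α β : Fin N) (x y : Λ) (Φ : Fock (Mode Λ N)) :
    c y β (createKer T α x Φ) =
      (if β = α then projMatrix T y x • Φ else 0) - createKer T α x (c y β Φ) := by
  simp only [createKer, LinearMap.sum_apply, LinearMap.smul_apply, map_sum, map_smul,
    c_cdag_apply, smul_sub, Finset.sum_sub_distrib, smul_ite, smul_zero, ite_and]
  simp

lemma totalNum_createKer_apply {T : Matrix Λ Λ ℂ} {x : Λ} {α : Fin N} {Φ : Fock (Mode Λ N)} {a : ℂ}
    (h : totalNum Λ N Φ = a • Φ) :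
    totalNum Λ N (createKer T α x Φ) = (a + 1) • createKer T α x Φ := by
  simp only [createKer, LinearMap.sum_apply, LinearMap.smul_apply, map_sum, map_smul,
    totalNum_cdag_apply h, Finset.smul_sum]
  exact Finset.sum_congr rfl fun y _ => smul_comm _ _ _

/-- The states of particles of color `α` in the kernel of the hopping matrix. -/
structure IsKerState (T : Matrix Λ Λ ℂ) (α : Fin N) (Φ : Fock (Mode Λ N)) : Prop where
  color : ∀ x β, β ≠ α → c x β Φ = 0
  ker : ∀ x, ∑ y, projMatrix T x y • c y α Φ = c x α Φ

lemma IsKerState.createKer {T : Matrix Λ Λ ℂ} {α : Fin N} {Φ : Fock (Mode Λ N)}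
    (h : IsKerState T α Φ) (x : Λ) : IsKerState T α (createKer T α x Φ) where
  color y β hβ := by rw [c_createKer_apply, if_neg hβ, h.color y β hβ, map_zero, sub_zero]
  ker y := by
    simp_rw [c_createKer_apply, if_true, smul_sub, Finset.sum_sub_distrib, sum_smul_map,
      h.ker, smul_smul, ← Finset.sum_smul, projMatrix_mul_self_apply]

lemma c_vacuum (x : Λ) (α : Fin N) :
    c x α (EuclideanSpace.single ∅ (1 : ℂ) : Fock (Mode Λ N)) = 0 := by
  ext S
  simp [c, annihilate_apply]

/-- The state of color `α` in which the kernel of the hopping matrix is filled. -/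
structure IsFilledSea (T : Matrix Λ Λ ℂ) (α : Fin N) (Ψ : Fock (Mode Λ N)) : Prop
    extends IsKerState T α Ψ where
  ne_zero : Ψ ≠ 0
  filled : ∀ x, SUNHubbard.createKer T α x Ψ = 0

/-- The vacuum is a kernel state, and only finitely many particle numbers occur. In a kernel state
with the most particles no further kernel orbital can be created. -/
lemma exists_isFilledSea (T : Matrix Λ Λ ℂ) (α : Fin N) : ∃ Ψ, IsFilledSea T α Ψ := by
  let K : Set ℕ := {k | ∃ Ψ, Ψ ≠ 0 ∧ IsKerState T α Ψ ∧ totalNum Λ N Ψ = (k : ℂ) • Ψ}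
  have hne : K.Nonempty := by
    refine ⟨0, EuclideanSpace.single ∅ 1, ?_, ⟨?_, ?_⟩, ?_⟩
    · simp
    · intro x β _
      exact c_vacuum x β
    · simp [c_vacuum]
    · simp [totalNum, num, c_vacuum]
  have hfin : K.Finite := by
    refine ((Module.End.finite_hasEigenvalue (totalNum Λ N)).preimage
      (Nat.cast_injective (R := ℂ)).injOn).subset ?_
    rintro k ⟨Ψ, h0, -, hk⟩
    exact Module.End.hasEigenvalue_of_hasEigenvector ⟨Module.End.mem_eigenspace_iff.mpr hk, h0⟩
  obtain ⟨k, ⟨Ψ, h0, hΨ, hk⟩, hmax⟩ := Set.exists_max_image K id hfin hne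
  refine ⟨Ψ, hΨ, h0, fun x => ?_⟩
  by_contra hx
  have : k + 1 ∈ K := ⟨_, hx, hΨ.createKer x, by
    rw [totalNum_createKer_apply hk]
    push_cast
    rfl⟩
  have := hmax _ this
  simp at this

variable {T : Matrix Λ Λ ℂ} {α : Fin N} {Ψ : Fock (Mode Λ N)}

/-- Inserting P into the number operator turns it into the sum over y of `createKer T α y * c y α`.
On a filled sea each term acts as P y y, and the trace of P is the dimension of the kernel. -/
lemma IsFilledSea.mem_sector (h : IsFilledSea T α Ψ) : Ψ ∈ sector Λ N (kerDim T) := by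
  rw [SUNHubbard.mem_sector, totalNum, LinearMap.sum_apply]
  have h1 (x : Λ) : (∑ β, num x β) Ψ = ∑ y, projMatrix T x y • cdag x α (c y α Ψ) := by
    rw [LinearMap.sum_apply, Finset.sum_eq_single α]
    · rw [num, Module.End.mul_apply, ← h.ker, map_sum]
      simp_rw [map_smul]
    · intro β _ hβ
      rw [num, Module.End.mul_apply, h.color x β hβ, map_zero]
    · simp
  have h2 (y : Λ) :
      ∑ x, projMatrix T x y • cdag x α (c y α Ψ) = projMatrix T y y • Ψ := by
    have := c_createKer_apply T α α y y Ψ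
    rw [h.filled, map_zero, if_pos rfl, eq_comm, sub_eq_zero] at this
    simp [this, createKer]
  simp_rw [h1]
  rw [Finset.sum_comm]
  simp_rw [h2, ← Finset.sum_smul, trace_projMatrix]

lemma IsKerState.hop_null (h : IsKerState T α Ψ) (x : Λ) (β : Fin N) :
    ∑ y, T x y • c y β Ψ = 0 := by
  rcases eq_or_ne β α with rfl | hβ
  · rw [Finset.sum_congr rfl fun y _ => congrArg (T x y • ·) (h.ker y).symm]
    simp_rw [Finset.smul_sum, smul_smul]
    rw [Finset.sum_comm]
    simp_rw [← Finset.sum_smul, sum_mul_projMatrix, zero_smul, Finset.sum_const_zero]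
  · simp [h.color _ β hβ]

lemma IsKerState.c_c_eq_zero (h : IsKerState T α Ψ) {x y : Λ} {β γ : Fin N}
    (hβγ : β ≠ α ∨ γ ≠ α) : c y γ (c x β Ψ) = 0 := by
  rcases hβγ with hβ | hγ
  · rw [h.color x β hβ, map_zero]
  · rw [c_anticomm_apply, h.color y γ hγ, map_zero, neg_zero]

lemma IsKerState.c_c_self (h : IsKerState T α Ψ) (x : Λ) (β γ : Fin N) :
    c x γ (c x β Ψ) = 0 := by
  by_cases hβγ : β ≠ α ∨ γ ≠ α
  · exact h.c_c_eq_zero hβγ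
  · push Not at hβγ
    rw [hβγ.1, hβγ.2, c_self_apply]

lemma IsKerState.hamiltonian_apply (h : IsKerState T α Ψ) (hT : T.PosSemidef) {U : ℝ}
    (hU : 0 < U) : hamiltonian N T U Ψ = 0 :=
  (hamiltonian_apply_eq_zero_iff hT hU).mpr ⟨h.hop_null, h.c_c_self⟩

lemma IsKerState.color_symm (h : IsKerState T α Ψ) (x y : Λ) (β γ : Fin N) :
    c y γ (c x β Ψ) = c y β (c x γ Ψ) := by
  by_cases hβγ : β ≠ α ∨ γ ≠ α
  · rw [h.c_c_eq_zero hβγ, h.c_c_eq_zero hβγ.symm]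
  · push Not at hβγ
    rw [hβγ.1, hβγ.2]

theorem isGreatest_casimir (hN : N ≠ 0) (T : Matrix Λ Λ ℂ) :
    IsGreatest (sectorEigenvalues (casimir Λ N) (kerDim T)) (polarizedValue N (kerDim T)) := by
  obtain ⟨Ψ, h⟩ := exists_isFilledSea (N := N) T ⟨0, Nat.pos_of_ne_zero hN⟩
  exact ⟨⟨Ψ, h.mem_sector, h.ne_zero,
    (casimir_eq_polarizedValue_iff hN h.mem_sector).mpr h.color_symm⟩,
    fun _ => casimir_eigenvalue_le hN⟩

lemma isLeast_hamiltonian (hN : N ≠ 0) (hT : T.PosSemidef) {U : ℝ} (hU : 0 < U) :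
    IsLeast (sectorEigenvalues (hamiltonian N T U) (kerDim T)) 0 := by
  obtain ⟨Ψ, h⟩ := exists_isFilledSea (N := N) T ⟨0, Nat.pos_of_ne_zero hN⟩
  refine ⟨⟨Ψ, h.mem_sector, h.ne_zero, ?_⟩, fun _ => hamiltonian_eigenvalue_nonneg hT hU⟩
  rw [h.hamiltonian_apply hT hU, Complex.ofReal_zero, zero_smul]

lemma isGroundState_iff (hN : N ≠ 0) (hT : T.PosSemidef) {U : ℝ} (hU : 0 < U)
    {Φ : Fock (Mode Λ N)} :
    IsGroundState (hamiltonian N T U) (kerDim T) Φ ↔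
      Φ ∈ sector Λ N (kerDim T) ∧ Φ ≠ 0 ∧ (∀ x α, ∑ y, T x y • c y α Φ = 0) ∧
        ∀ x α β, c x β (c x α Φ) = 0 := by
  rw [← hamiltonian_apply_eq_zero_iff hT hU, IsGroundState]
  have h0 := isLeast_hamiltonian hN hT hU
  refine and_congr_right fun _ => and_congr_right fun _ => ⟨?_, fun h => ⟨0, h0, by simpa using h⟩⟩
  rintro ⟨E, hE, h⟩
  rw [h, hE.unique h0, Complex.ofReal_zero, zero_smul]

end FilledSea

/-! ### Reducible projection matrix: a ground state that is not polarized -/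

section Reducible

variable {Λ : Type*} [Fintype Λ] [LinearOrder Λ] {N : ℕ}

open Classical in
/-- The change of color from `α` to `β` at the sites of `L`. -/
def recolor (L : Set Λ) (α β : Fin N) : Op Λ N := ∑ y, if y ∈ L then cdag y β * c y α else 0

open Classical in
lemma c_recolor_apply (L : Set Λ) (α β γ : Fin N) (x : Λ) (Φ : Fock (Mode Λ N)) :
    c x γ (recolor L α β Φ) =
      recolor L α β (c x γ Φ) + if γ = β ∧ x ∈ L then c x α Φ else 0 := by
  have h : c x γ * recolor L α β =
      recolor L α β * c x γ + if γ = β ∧ x ∈ L then c x α else 0 := by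
    have h1 (y : Λ) : (c x γ * if y ∈ L then cdag y β * c y α else 0) =
        (if y ∈ L then cdag y β * c y α else 0) * c x γ +
          if x = y then (if γ = β ∧ x ∈ L then c x α else 0) else 0 := by
      split_ifs <;> simp_all [c_mul_cdag_mul_c]
    simp_rw [recolor, Finset.mul_sum, h1, Finset.sum_add_distrib, Finset.sum_mul]
    simp
  have := LinearMap.congr_fun h Φ
  rw [Module.End.mul_apply] at this
  rw [this]
  split_ifs <;> simp

lemma totalNum_recolor_apply {L : Set Λ} {α β : Fin N} {Φ : Fock (Mode Λ N)} {a : ℂ}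
    (h : totalNum Λ N Φ = a • Φ) :
    totalNum Λ N (recolor L α β Φ) = a • recolor L α β Φ := by
  rw [recolor, LinearMap.sum_apply, map_sum, Finset.smul_sum]
  refine Finset.sum_congr rfl fun y _ => ?_
  split_ifs
  · rw [Module.End.mul_apply, totalNum_cdag_apply (totalNum_c_apply h), sub_add_cancel]
  · simp

theorem not_isFerromagnetic_of_isReducibleOn (hN : 2 ≤ N) {T : Matrix Λ Λ ℂ} (hT : T.PosSemidef)
    {U : ℝ} (hU : 0 < U) (h : IsReducibleOn (projMatrix T) (diagSupport (projMatrix T))) :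
    ¬ IsFerromagnetic N T U (kerDim T) := by
  classical
  intro hferro
  obtain ⟨L₁, L₂, hL, hdisj, ⟨x, hx⟩, ⟨y, hy⟩, hP⟩ := h
  have hN0 : N ≠ 0 := by omega
  let α : Fin N := ⟨0, by omega⟩
  let β : Fin N := ⟨1, by omega⟩
  have hαβ : α ≠ β := by simp [α, β]
  have hP' (u v : Λ) (hu : u ∈ L₂) (hv : v ∈ L₁) : projMatrix T u v = 0 := by
    rw [← projMatrix_conj, hP v hv u hu, star_zero]
  -- The indicator of L₂ commutes with P, so restricting a kernel vector to L₂ stays in the kernel.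
  have hblock (u v : Λ) : (if u ∈ L₂ then projMatrix T u v else 0) =
      if v ∈ L₂ then projMatrix T u v else 0 := by
    by_cases h0 : projMatrix T u v = 0
    · simp [h0]
    have hu : u ∈ L₁ ∪ L₂ := hL ▸ projMatrix_self_ne_zero_of_ne_zero h0
    have hv : v ∈ L₁ ∪ L₂ := by
      refine hL ▸ projMatrix_self_ne_zero_of_ne_zero (y := u) ?_
      rwa [← projMatrix_conj, star_ne_zero]
    have h12 : u ∈ L₁ → v ∉ L₂ := fun hu hv => h0 (hP u hu v hv)
    have h21 : u ∈ L₂ → v ∉ L₁ := fun hu hv => h0 (hP' u v hu hv)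
    have : u ∈ L₂ ↔ v ∈ L₂ :=
      ⟨fun h => hv.resolve_left (h21 h), fun h => hu.resolve_left fun h' => h12 h' h⟩
    simp [this]
  obtain ⟨Ψ, hΨ⟩ := exists_isFilledSea T α
  have hsec : recolor L₂ α β Ψ ∈ sector Λ N (kerDim T) :=
    mem_sector.mpr (totalNum_recolor_apply (mem_sector.mp hΨ.mem_sector))
  have hsymm : ∀ x y γ δ, c y δ (c x γ (recolor L₂ α β Ψ)) = c y γ (c x δ (recolor L₂ α β Ψ)) := by
    by_cases h0 : recolor L₂ α β Ψ = 0
    · simp [h0]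
    refine (casimir_eq_polarizedValue_iff hN0 hsec).mp
      (hferro _ ((isGroundState_iff hN0 hT hU).mpr ⟨hsec, h0, fun u γ => ?_, fun u γ δ => ?_⟩))
    · simp_rw [c_recolor_apply, smul_add, Finset.sum_add_distrib, sum_smul_map]
      rw [hΨ.hop_null, map_zero, zero_add]
      by_cases hγ : γ = β
      · have h1 (v : Λ) : (if γ = β ∧ v ∈ L₂ then c v α Ψ else 0) =
            ∑ w, (if w ∈ L₂ then projMatrix T v w else 0) • c w α Ψ := by
          simp_rw [← hblock, hγ, true_and]
          split_ifs
          · rw [hΨ.ker]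
          · simp
        simp_rw [h1, Finset.smul_sum, smul_smul]
        rw [Finset.sum_comm]
        refine Finset.sum_eq_zero fun w _ => ?_
        rw [← Finset.sum_smul]
        split_ifs
        · rw [sum_mul_projMatrix, zero_smul]
        · simp
      · simp [hγ]
    · rw [c_recolor_apply, map_add, c_recolor_apply, hΨ.c_c_self, map_zero, zero_add,
        apply_ite (c u δ), hΨ.c_c_self, hΨ.c_c_self]
      simp
  -- Color symmetry of the recolored state at x ∈ L₁, y ∈ L₂: one side is c_{y,α} c_{x,α} Ψ, while
  -- the other vanishes because no particle at x has color β.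
  have hcc : c x α (c y α Ψ) = 0 := by
    have h1 := hsymm x y α β
    have hx2 : x ∉ L₂ := fun h => Set.disjoint_left.mp hdisj hx h
    simp only [c_recolor_apply, hx2, and_false, if_false, add_zero, hαβ, hy, and_true,
      if_true, hΨ.color x β hαβ.symm, map_zero, hΨ.c_c_eq_zero (Or.inr hαβ.symm), zero_add] at h1
    rw [c_anticomm_apply, h1, neg_zero]
  have hker : createKer T α x (c y α Ψ) = 0 := by
    have h1 := c_createKer_apply T α α x y Ψ
    rw [hΨ.filled, map_zero, hP' y x hy hx] at h1
    simpa using h1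
  have hxx : projMatrix T x x ≠ 0 := by
    have : x ∈ diagSupport (projMatrix T) := hL ▸ Or.inl hx
    exact this
  have hyy : projMatrix T y y ≠ 0 := by
    have : y ∈ diagSupport (projMatrix T) := hL ▸ Or.inr hy
    exact this
  -- As P y x = 0, the orbital at x stays filled after a particle is removed at y. Anticommuting `c
  -- x α` past its creation operator then leaves only P x x times `c y α Ψ`.
  have hcy : c y α Ψ = 0 := by
    have h1 := c_createKer_apply T α α x x (c y α Ψ)
    rw [hker, hcc, map_zero, map_zero, if_pos rfl, sub_zero, eq_comm, smul_eq_zero] at h1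
    exact h1.resolve_left hxx
  have h1 := c_createKer_apply T α α y y Ψ
  rw [hΨ.filled, hcy, map_zero, map_zero, if_pos rfl, sub_zero, eq_comm, smul_eq_zero] at h1
  exact hΨ.ne_zero (h1.resolve_left hyy)

end Reducible

/-! ### Bases of the kernel dual to evaluations at sites -/

section EvaluationBasis

variable {Λ : Type*} [Fintype Λ] [DecidableEq Λ]

/-- `l` restricted to `I` is a basis of `K`, dual to the evaluations at the sites of `I`. -/
structure IsEvaluationBasis (K : Submodule ℂ (EuclideanSpace ℂ Λ)) (I : Finset Λ)
    (l : Λ → EuclideanSpace ℂ Λ) : Prop where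
  card : I.card = Module.finrank ℂ K
  mem : ∀ z ∈ I, l z ∈ K
  self : ∀ z ∈ I, l z z = 1
  expand : ∀ f ∈ K, ∀ x, f x = ∑ z ∈ I, l z x * f z

/-- The evaluations separate the vectors of K, so a maximal linearly independent family of them
gives coordinates on K; `l` is the corresponding dual basis. -/
lemma exists_isEvaluationBasis (K : Submodule ℂ (EuclideanSpace ℂ Λ)) :
    ∃ I l, IsEvaluationBasis K I l := by
  let v (x : Λ) : Module.Dual ℂ K := (EuclideanSpace.proj x : _ →L[ℂ] ℂ).toLinearMap ∘ₗ K.subtype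
  have hv (x : Λ) (f : K) : v x f = (f : EuclideanSpace ℂ Λ) x := rfl
  obtain ⟨κ, a, ha, hspan, hli⟩ := exists_linearIndependent' ℂ v
  have : Finite κ := Finite.of_injective a ha
  have := Fintype.ofFinite κ
  classical
  let e : K →ₗ[ℂ] (κ → ℂ) := LinearMap.pi fun k => v (a k)
  have he : Function.Injective e := by
    rw [← LinearMap.ker_eq_bot, LinearMap.ker_eq_bot']
    intro f hf
    have h1 : Submodule.span ℂ (Set.range (v ∘ a)) ≤ LinearMap.ker (Module.Dual.eval ℂ K f) := by
      rw [Submodule.span_le]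
      rintro _ ⟨k, rfl⟩
      exact congrFun hf k
    rw [hspan] at h1
    ext x
    exact h1 (Submodule.subset_span ⟨x, rfl⟩)
  have hcard : Fintype.card κ = Module.finrank ℂ K := by
    apply le_antisymm
    · rw [← Subspace.dual_finrank_eq (K := ℂ) (V := K)]
      exact hli.fintype_card_le_finrank
    · simpa using LinearMap.finrank_le_finrank_of_injective he
  let e' : K ≃ₗ[ℂ] (κ → ℂ) := LinearEquiv.ofInjectiveOfFinrankEq e he (by simp [hcard])
  have he' (f : K) (k : κ) : e' f k = (f : EuclideanSpace ℂ Λ) (a k) := rfl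
  let l : Λ → EuclideanSpace ℂ Λ := Function.extend a (fun k => (e'.symm (Pi.single k 1) : K)) 0
  have hl (k : κ) : l (a k) = (e'.symm (Pi.single k 1) : K) := ha.extend_apply _ _ _
  refine ⟨Finset.univ.image a, l, ?_, ?_, ?_, ?_⟩
  · rw [Finset.card_image_of_injective _ ha, Finset.card_univ, hcard]
  · simp [hl]
  · simp only [Finset.mem_image, Finset.mem_univ, true_and, forall_exists_index,
      forall_apply_eq_imp_iff, hl, ← he', LinearEquiv.apply_symm_apply, Pi.single_eq_same,
      implies_true]
  · intro f hf x
    rw [Finset.sum_image ha.injOn]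
    have h1 : (⟨f, hf⟩ : K) = ∑ k, f (a k) • e'.symm (Pi.single k 1) := by
      apply e'.injective
      ext k
      rw [map_sum]
      simp_rw [map_smul, LinearEquiv.apply_symm_apply]
      simp [he', Pi.single_apply]
    have h2 := congrArg (v x) h1
    simpa [hv, hl, mul_comm] using h2

variable {T : Matrix Λ Λ ℂ} {I : Finset Λ} {l : Λ → EuclideanSpace ℂ Λ}

/-- Sites of an evaluation basis of the kernel are connected if the projection matrix
is irreducible. -/
lemma IsEvaluationBasis.connected (hl : IsEvaluationBasis (kerSpace T) I l)
    (h : IsIrreducibleOn (projMatrix T) (diagSupport (projMatrix T))) {z w : Λ}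
    (hz : z ∈ I) (hw : w ∈ I) :
    Relation.ReflTransGen (fun u v => u ∈ I ∧ v ∈ I ∧ ∃ x, l u x ≠ 0 ∧ l v x ≠ 0) z w := by
  by_contra hzw
  set R : Λ → Λ → Prop := fun u v => u ∈ I ∧ v ∈ I ∧ ∃ x, l u x ≠ 0 ∧ l v x ≠ 0
  -- The supports of the orbitals reachable from z and of the others. Orbitals with intersecting
  -- supports are joined by an edge, so these sets are disjoint.
  let L₁ : Set Λ := {x | ∃ u ∈ I, Relation.ReflTransGen R z u ∧ l u x ≠ 0}
  let L₂ : Set Λ := {x | ∃ u ∈ I, ¬ Relation.ReflTransGen R z u ∧ l u x ≠ 0}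
  have hdisj (x : Λ) (h1 : x ∈ L₁) (h2 : x ∈ L₂) : False := by
    obtain ⟨u, hu, hzu, hux⟩ := h1
    obtain ⟨v, hv, hzv, hvx⟩ := h2
    exact hzv (hzu.tail ⟨hu, hv, x, hux, hvx⟩)
  refine h ⟨L₁, L₂, ?_, Set.disjoint_left.mpr hdisj, ⟨z, z, hz, .refl, ?_⟩, ⟨w, w, hw, hzw, ?_⟩, ?_⟩
  · ext x
    constructor
    · intro hx
      have hx' : projMatrix T x x ≠ 0 := hx
      rw [show projMatrix T x x = _ from hl.expand _ (projMatrix_column_mem T x) x] at hx'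
      obtain ⟨u, hu, hux⟩ := Finset.exists_ne_zero_of_sum_ne_zero hx'
      by_cases hzu : Relation.ReflTransGen R z u
      · exact Or.inl ⟨u, hu, hzu, left_ne_zero_of_mul hux⟩
      · exact Or.inr ⟨u, hu, hzu, left_ne_zero_of_mul hux⟩
    · intro hx
      obtain ⟨u, hu, hux⟩ : ∃ u ∈ I, l u x ≠ 0 := by
        rcases hx with ⟨u, hu, -, hux⟩ | ⟨u, hu, -, hux⟩ <;> exact ⟨u, hu, hux⟩
      rw [← sum_projMatrix_mul_of_mem (hl.mem u hu) x] at hux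
      obtain ⟨y, -, hy⟩ := Finset.exists_ne_zero_of_sum_ne_zero hux
      exact projMatrix_self_ne_zero_of_ne_zero (left_ne_zero_of_mul hy)
  · rw [hl.self z hz]
    exact one_ne_zero
  · rw [hl.self w hw]
    exact one_ne_zero
  · intro x hx y hy
    classical
    let f (p : Λ → Prop) [DecidablePred p] : EuclideanSpace ℂ Λ :=
      ∑ u ∈ I with p u, projMatrix T u y • l u
    let f₁ := f fun u => Relation.ReflTransGen R z u
    let f₂ := f fun u => ¬ Relation.ReflTransGen R z u
    have hf₁ : f₁ ∈ kerSpace T := Submodule.sum_mem _ fun u hu =>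
      Submodule.smul_mem _ _ (hl.mem u (Finset.mem_filter.mp hu).1)
    have happ₁ (t : Λ) (ht : t ∈ L₂) : f₁ t = 0 := by
      simp only [f₁, f, WithLp.ofLp_sum, WithLp.ofLp_smul, Finset.sum_apply, Pi.smul_apply]
      refine Finset.sum_eq_zero fun u hu => ?_
      rw [Finset.mem_filter] at hu
      by_contra h0
      exact hdisj t ⟨u, hu.1, hu.2, right_ne_zero_of_smul h0⟩ ht
    have happ₂ (t : Λ) (ht : t ∈ L₁) : f₂ t = 0 := by
      simp only [f₂, f, WithLp.ofLp_sum, WithLp.ofLp_smul, Finset.sum_apply, Pi.smul_apply]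
      refine Finset.sum_eq_zero fun u hu => ?_
      rw [Finset.mem_filter] at hu
      by_contra h0
      exact hdisj t ht ⟨u, hu.1, hu.2, right_ne_zero_of_smul h0⟩
    have hadd (t : Λ) : f₁ t + f₂ t = projMatrix T t y := by
      rw [show projMatrix T t y = _ from hl.expand _ (projMatrix_column_mem T y) t]
      simp only [f₁, f₂, f, WithLp.ofLp_sum, WithLp.ofLp_smul, Finset.sum_apply, Pi.smul_apply]
      rw [Finset.sum_filter_add_sum_filter_not]
      exact Finset.sum_congr rfl fun u _ => mul_comm _ _
    -- Column y of P is f₁ + f₂ with disjoint supports, and f₁ lies in the kernel. So ‖f₁‖² is the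
    -- inner product of column y with f₁, that is (P f₁)(y) = f₁(y), which is 0 as y ∈ L₂.
    have hzero : ∑ t, Complex.normSq (f₁ t) = 0 := by
      have h1 := sum_projMatrix_mul_of_mem hf₁ y
      rw [happ₁ y hy] at h1
      rw [← Complex.ofReal_inj, Complex.ofReal_sum, Complex.ofReal_zero, ← h1]
      refine Finset.sum_congr rfl fun t _ => ?_
      rw [← projMatrix_conj, ← hadd, ← Complex.mul_conj, mul_comm]
      by_cases h0 : f₁ t = 0
      · simp [h0]
      · rw [happ₂ t, add_zero]
        · rfl
        · by_contra ht
          refine h0 ?_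
          simp only [f₁, f, WithLp.ofLp_sum, WithLp.ofLp_smul, Finset.sum_apply, Pi.smul_apply]
          refine Finset.sum_eq_zero fun u hu => ?_
          rw [Finset.mem_filter] at hu
          by_contra h0
          exact ht ⟨u, hu.1, hu.2, right_ne_zero_of_smul h0⟩
    rw [Finset.sum_eq_zero_iff_of_nonneg fun _ _ => Complex.normSq_nonneg _] at hzero
    rw [← hadd, happ₂ x hx, add_zero]
    exact Complex.normSq_eq_zero.mp (hzero x (Finset.mem_univ x))

end EvaluationBasis

/-! ### Irreducible projection matrix: exchange symmetry of the ground states -/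

section Irreducible

variable {Λ : Type*} [Fintype Λ] [LinearOrder Λ] {N : ℕ}

lemma colorAntisymm_apply (x y : Λ) (α β : Fin N) (Φ : Fock (Mode Λ N)) :
    colorAntisymm ((x, y), (α, β)) Φ = c y β (c x α Φ) - c y α (c x β Φ) := rfl

lemma c_c_c_apply (x y z : Λ) (α β γ : Fin N) (Φ : Fock (Mode Λ N)) :
    c z γ (c y β (c x α Φ)) = c y β (c x α (c z γ Φ)) := by
  rw [c_anticomm_apply z y, c_anticomm_apply z x, map_neg, neg_neg]

lemma c_colorAntisymm_apply (z : Λ) (γ : Fin N) (p : (Λ × Λ) × (Fin N × Fin N))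
    (Φ : Fock (Mode Λ N)) : c z γ (colorAntisymm p Φ) = colorAntisymm p (c z γ Φ) := by
  obtain ⟨⟨x, y⟩, α, β⟩ := p
  rw [colorAntisymm_apply, map_sub, c_c_c_apply, c_c_c_apply x y, colorAntisymm_apply]

/-- States of `S.card` particles without double occupancy of a site, spanned by the orbitals
`l z` for the sites `z ∈ S` among the sites of `I`. -/
structure IsSinglyOccupied (I : Finset Λ) (l : Λ → EuclideanSpace ℂ Λ) (S : Finset Λ)
    (Φ : Fock (Mode Λ N)) : Prop where
  num : totalNum Λ N Φ = (S.card : ℂ) • Φ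
  expand : ∀ x α, c x α Φ = ∑ z ∈ I, l z x • c z α Φ
  single : ∀ x α β, c x β (c x α Φ) = 0
  empty : ∀ z ∈ I, z ∉ S → ∀ α, c z α Φ = 0

variable {I S : Finset Λ} {l : Λ → EuclideanSpace ℂ Λ} {Φ : Fock (Mode Λ N)}

namespace IsSinglyOccupied

lemma erase (h : IsSinglyOccupied I l S Φ) {w : Λ} (hw : w ∈ S) (γ : Fin N) :
    IsSinglyOccupied I l (S.erase w) (c w γ Φ) where
  num := by
    rw [totalNum_c_apply h.num, Finset.card_erase_of_mem hw,
      Nat.cast_sub (Finset.card_pos.mpr ⟨w, hw⟩), Nat.cast_one]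
  expand x α := by
    rw [c_anticomm_apply, h.expand, ← sum_smul_map, ← Finset.sum_neg_distrib]
    exact Finset.sum_congr rfl fun z _ => by rw [c_anticomm_apply z w, smul_neg]
  single x α β := by rw [← c_c_c_apply, h.single, map_zero]
  empty z hz hzS α := by
    rw [Finset.mem_erase, not_and_or, not_not] at hzS
    rcases hzS with rfl | hzS
    · exact h.single _ _ _
    · rw [c_anticomm_apply, h.empty z hz hzS, map_zero, neg_zero]

lemma colorAntisymm_eq_zero_of_notMem (h : IsSinglyOccupied I l S Φ) {z w : Λ} (hz : z ∈ I)
    (hw : w ∈ I) (hzw : z ∉ S ∨ w ∉ S) (α β : Fin N) : colorAntisymm ((z, w), (α, β)) Φ = 0 := by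
  rw [colorAntisymm_apply]
  rcases hzw with hz' | hw'
  · rw [h.empty z hz hz', h.empty z hz hz', map_zero, map_zero, sub_zero]
  · rw [c_anticomm_apply, c_anticomm_apply w z, h.empty w hw hw', h.empty w hw hw', map_zero,
      map_zero, sub_self]

lemma colorAntisymm_self (h : IsSinglyOccupied I l S Φ) (z : Λ) (α β : Fin N) :
    colorAntisymm ((z, z), (α, β)) Φ = 0 := by
  rw [colorAntisymm_apply, h.single, h.single, sub_zero]

/-- It suffices to check color symmetry after the removal of any other particle. -/
lemma colorAntisymm_eq_zero_of_removal (h : IsSinglyOccupied I l S Φ) {z w : Λ} {α β : Fin N}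
    (hS : 2 < S.card)
    (hc : ∀ u ∈ S, u ≠ z → u ≠ w → ∀ γ, colorAntisymm ((z, w), (α, β)) (c u γ Φ) = 0) :
    colorAntisymm ((z, w), (α, β)) Φ = 0 := by
  have hnum : totalNum Λ N (colorAntisymm ((z, w), (α, β)) Φ) =
      ((S.card : ℂ) - 1 - 1) • colorAntisymm ((z, w), (α, β)) Φ := by
    rw [colorAntisymm_apply, map_sub, smul_sub, totalNum_c_apply (totalNum_c_apply h.num),
      totalNum_c_apply (totalNum_c_apply h.num)]
  -- At least one particle remains, so it suffices that every further annihilation gives zero. By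
  -- `expand` only sites of I matter; z and w themselves give zero by single occupancy.
  refine eq_zero_of_c_eq_zero hnum ?_ fun x γ => ?_
  · have : (S.card : ℂ) - 1 - 1 = ((S.card - 2 : ℕ) : ℂ) := by
      rw [Nat.cast_sub hS.le]
      push_cast
      ring
    rw [this, Nat.cast_ne_zero]
    omega
  · rw [c_colorAntisymm_apply, h.expand, ← sum_smul_map]
    refine Finset.sum_eq_zero fun u hu => ?_
    suffices colorAntisymm ((z, w), (α, β)) (c u γ Φ) = 0 by rw [this, smul_zero]
    by_cases huS : u ∈ S
    · rcases eq_or_ne u z with rfl | huz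
      · rw [colorAntisymm_apply, h.single, h.single, map_zero, map_zero, sub_zero]
      rcases eq_or_ne u w with rfl | huw
      · rw [colorAntisymm_apply, c_anticomm_apply u z, c_anticomm_apply u z, h.single, h.single,
          map_zero, map_zero, sub_self]
      exact hc u huS huz huw γ
    · rw [h.empty u hu huS, map_zero]

/-- Exchange symmetry for two orbitals that overlap at a site. -/
lemma colorAntisymm_of_overlap (h : IsSinglyOccupied I l S Φ) {z w x : Λ} (hz : z ∈ I)
    (hw : w ∈ I) (hzx : l z x ≠ 0) (hwx : l w x ≠ 0) (α β : Fin N) :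
    colorAntisymm ((z, w), (α, β)) Φ = 0 := by
  rcases eq_or_ne z w with rfl | hzw
  · exact h.colorAntisymm_self z α β
  induction S using Finset.strongInduction generalizing Φ with
  | H S ih =>
  by_cases hmem : z ∉ S ∨ w ∉ S
  · exact h.colorAntisymm_eq_zero_of_notMem hz hw hmem α β
  push Not at hmem
  have hsub : {z, w} ⊆ S := by simp [Finset.insert_subset_iff, hmem]
  rcases eq_or_ne {z, w} S with hS | hS
  · have hex (γ : Fin N) : c x γ Φ = l z x • c z γ Φ + l w x • c w γ Φ := by
      rw [h.expand, ← Finset.sum_pair (f := fun u => l u x • c u γ Φ) hzw]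
      symm
      refine Finset.sum_subset (by simp [Finset.insert_subset_iff, hz, hw]) fun u hu huS => ?_
      rw [h.empty u hu (hS ▸ huS), smul_zero]
    -- With two particles left, c_{x,β} c_{x,α} Φ = 0 expands to l z x · l w x times the
    -- antisymmetrization at z and w; the terms with both particles at z or both at w vanish.
    have h1 := h.single x α β
    have h2 : c x β (c z α Φ) = l w x • c w β (c z α Φ) := by
      rw [c_anticomm_apply, hex, map_add, map_smul, map_smul, h.single, smul_zero, zero_add,
        c_anticomm_apply z w, smul_neg, neg_neg]
    have h3 : c x β (c w α Φ) = -(l z x • c w α (c z β Φ)) := by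
      rw [c_anticomm_apply, hex, map_add, map_smul, map_smul, h.single, smul_zero, add_zero]
    rw [hex, map_add, map_smul, map_smul, h2, h3, smul_neg, smul_smul, smul_smul,
      mul_comm (l w x), ← sub_eq_add_neg, ← smul_sub] at h1
    exact (smul_eq_zero.mp h1).resolve_left (mul_ne_zero hzx hwx)
  · have hcard : 2 < S.card := by
      rw [← Finset.card_pair hzw]
      exact Finset.card_lt_card (hsub.ssubset_of_ne hS)
    exact h.colorAntisymm_eq_zero_of_removal hcard fun u hu _ _ γ =>
      ih _ (Finset.erase_ssubset hu) (h.erase hu γ)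

/-- The transposition of z and w is the product (z u)(u w)(z u). Other particles are removed by
induction until the one removed is at u, where this identity applies. -/
lemma colorAntisymm_trans (h : IsSinglyOccupied I l S Φ) {z u w : Λ} (hz : z ∈ S)
    (hu : u ∈ S) (hw : w ∈ S) (hzu : ∀ α β, colorAntisymm ((z, u), (α, β)) Φ = 0)
    (huw : ∀ α β, colorAntisymm ((u, w), (α, β)) Φ = 0) (α β : Fin N) :
    colorAntisymm ((z, w), (α, β)) Φ = 0 := by
  rcases eq_or_ne z w with rfl | hzw
  · exact h.colorAntisymm_self z α β
  rcases eq_or_ne z u with rfl | hzu'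
  · exact huw α β
  rcases eq_or_ne u w with rfl | huw'
  · exact hzu α β
  induction S using Finset.strongInduction generalizing Φ with
  | H S ih =>
  have hcard : 2 < S.card := by
    exact Finset.two_lt_card.mpr ⟨z, hz, u, hu, w, hw, hzu', hzw, huw'⟩
  refine h.colorAntisymm_eq_zero_of_removal hcard fun v hv hvz hvw γ => ?_
  rcases eq_or_ne v u with rfl | hvu
  · have hzv (γ δ : Fin N) : c v γ (c z δ Φ) = c v δ (c z γ Φ) := sub_eq_zero.mp (hzu δ γ)
    have hvw (γ δ : Fin N) : c w γ (c v δ Φ) = c w δ (c v γ Φ) := sub_eq_zero.mp (huw δ γ)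
    rw [colorAntisymm_apply, sub_eq_zero]
    -- The colors are exchanged between z and v, then v and w, then z and v again.
    calc c w β (c z α (c v γ Φ)) = -c w β (c v γ (c z α Φ)) := by
          rw [c_anticomm_apply z v, map_neg]
      _ = -c w β (c v α (c z γ Φ)) := by rw [hzv]
      _ = -c w α (c v β (c z γ Φ)) := by rw [← c_c_c_apply, hvw, c_c_c_apply]
      _ = -c w α (c v γ (c z β Φ)) := by rw [hzv]
      _ = c w α (c z β (c v γ Φ)) := by rw [c_anticomm_apply z v, map_neg]
  · refine ih _ (Finset.erase_ssubset hv) (h.erase hv γ) (Finset.mem_erase.mpr ⟨hvz.symm, hz⟩)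
      (Finset.mem_erase.mpr ⟨hvu.symm, hu⟩) (Finset.mem_erase.mpr ⟨hvw.symm, hw⟩) ?_ ?_
    · intro γ δ
      rw [← c_colorAntisymm_apply, hzu, map_zero]
    · intro γ δ
      rw [← c_colorAntisymm_apply, huw, map_zero]

lemma c_c_expand (h : IsSinglyOccupied I l S Φ) (x y : Λ) (α β : Fin N) :
    c y β (c x α Φ) = ∑ z ∈ I, l z x • ∑ w ∈ I, l w y • c w β (c z α Φ) := by
  rw [h.expand x, ← sum_smul_map]
  refine Finset.sum_congr rfl fun z _ => ?_
  rw [c_anticomm_apply, h.expand y, ← sum_smul_map, ← Finset.sum_neg_distrib]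
  congr 1
  exact Finset.sum_congr rfl fun w _ => by rw [c_anticomm_apply w z, smul_neg]

end IsSinglyOccupied

/-- The annihilation operators on a state over the kernel of the hopping matrix are determined
by those at the sites of an evaluation basis. -/
lemma IsEvaluationBasis.c_expand {T : Matrix Λ Λ ℂ} (hl : IsEvaluationBasis (kerSpace T) I l)
    (h : ∀ x α, ∑ y, T x y • c y α Φ = 0) (x : Λ) (α : Fin N) :
    c x α Φ = ∑ z ∈ I, l z x • c z α Φ := by
  ext S
  have hmem : (WithLp.toLp 2 fun y => c y α Φ S) ∈ kerSpace T := by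
    rw [mem_kerSpace]
    intro x
    have := congrArg (fun Ψ : Fock (Mode Λ N) => Ψ S) (h x α)
    simpa using this
  have := hl.expand _ hmem x
  simpa using this

theorem isFerromagnetic_of_isIrreducibleOn (hN : N ≠ 0) {T : Matrix Λ Λ ℂ} (hT : T.PosSemidef)
    {U : ℝ} (hU : 0 < U) (h : IsIrreducibleOn (projMatrix T) (diagSupport (projMatrix T))) :
    IsFerromagnetic N T U (kerDim T) := by
  intro Φ hΦ
  obtain ⟨hsec, -, hhop, hint⟩ := (isGroundState_iff hN hT hU).mp hΦ
  obtain ⟨I, l, hl⟩ := exists_isEvaluationBasis (kerSpace T)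
  -- The choice of dim ker T particles enters here: their number is that of the sites in I, so the
  -- induction can start with S = I.
  have hs : IsSinglyOccupied I l I Φ :=
    ⟨by rw [hl.card]; exact mem_sector.mp hsec, hl.c_expand hhop, hint,
      fun z hz hz' => absurd hz hz'⟩
  have key (z w : Λ) (hz : z ∈ I) (hw : w ∈ I) (α β : Fin N) :
      colorAntisymm ((z, w), (α, β)) Φ = 0 := by
    have hconn := hl.connected h hz hw
    induction hconn generalizing α β with
    | refl => exact hs.colorAntisymm_self z α β
    | tail _ hvw ih =>
      obtain ⟨hv, hw, x, hvx, hwx⟩ := hvw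
      exact hs.colorAntisymm_trans hz hv hw (ih hv)
        (hs.colorAntisymm_of_overlap hv hw hvx hwx) α β
  rw [casimir_eq_polarizedValue_iff hN hsec]
  intro x y α β
  rw [hs.c_c_expand, hs.c_c_expand x y β α]
  refine Finset.sum_congr rfl fun z hz => congrArg _ (Finset.sum_congr rfl fun w hw => ?_)
  have h1 := key z w hz hw α β
  rw [colorAntisymm_apply, sub_eq_zero] at h1
  rw [h1]

end Irreducible

end SUNHubbard

end

theorem theorem1 {Λ : Type*} [Fintype Λ] [LinearOrder Λ] (N : ℕ) (hN : 2 ≤ N)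
    (T : Matrix Λ Λ ℂ) (hT : T.PosSemidef) (U : ℝ) (hU : 0 < U) :
    IsGreatest
        (SUNHubbard.sectorEigenvalues (SUNHubbard.casimir Λ N) (SUNHubbard.kerDim T))
        (SUNHubbard.polarizedValue N (SUNHubbard.kerDim T)) ∧
      (SUNHubbard.IsFerromagnetic N T U (SUNHubbard.kerDim T) ↔
        SUNHubbard.IsIrreducibleOn (SUNHubbard.projMatrix T)
          (SUNHubbard.diagSupport (SUNHubbard.projMatrix T))) := by
  have hN0 : N ≠ 0 := by omega
  exact ⟨SUNHubbard.isGreatest_casimir hN0 T,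
    fun h hred => SUNHubbard.not_isFerromagnetic_of_isReducibleOn hN hT hU hred h,
    SUNHubbard.isFerromagnetic_of_isIrreducibleOn hN0 hT hU⟩
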